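/- Fix $n\ge 0$ and propositional variables $p_1,\dots,p_n$. A *model* is a poset $X$ with an order-preserving map $c:X\to\{0,1\}^n$ (its colouring). For a variable $q$, a point $x$ is a *$q$-border point* if $q$ is false at $x$ and true at all $y>x$; $x$ is *separated* if it is a $q$-border point for some $q$. A p-morphism of models is a p-morphism of posets preserving colours; a generated submodel is an up-set with the restricted structure. The canonical model $C(n)$ is the set of prime filters of the Lindenbaum algebra of IPC in $n$ variables (theories with the disjunction property), ordered by inclusion, with $p_i$ true at $x$ iff $p_i\in x$; the universal model $U(n)$ consists of the points $x\in C(n)$ with ${\uparrow}x$ finite. $U(n)_{\wedge,\to}\subseteq U(n)$ is the image of the (unique) p-morphism of models $U(n)^s\to U(n)$, where $U(n)^s$ is the submodel of separated points of $U(n)$. For $w\in U(n)$ with set of immediate successors $I_w$, define recursively $$\theta_w=\bigvee_{w'\in I_w}\varphi_{w'},\qquad \varphi_w=\bigwedge_{p\text{ true at }w}p\ \wedge\bigwedge_{w\text{ is a }q\text{-border point}}(q\to\theta_w)\ \wedge\bigwedge_{w'\in I_w}(\psi_{w'}\to\theta_w),\qquad \psi_w=\varphi_w\to\theta_w .$$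 Let $F_{\wedge,\to}(n)$ be the (finite) set of $(\wedge,\to)$-formulas in $p_1,\dots,p_n$ modulo provable equivalence in IPC, ordered by provability, and let $\varphi\veebar\psi=\bigwedge\{\chi\in F_{\wedge,\to}(n): \varphi\le\chi,\ \psi\le\chi\}$. For a formula $\varphi$, let $s(\varphi)$ be the $(\wedge,\to)$-formula obtained by replacing $\vee$ by $\veebar$ and $\bot$ by $p_1\wedge\dots\wedge p_n$. (The constant $\top$, definable as $p\to p$, is allowed in $(\wedge,\to)$-formulas.) **Theorem.** Let $F$ be a finite poset with a least element (root) $r$, and let $A$ be the Heyting algebra of up-sets of $F$. 1. If $F=\{x_1,\dots,x_n\}$ with $n=|F|$, and $c$ is the colouring for which $p_j$ is true at $x$ iff $x\not\le x_j$, then the model $(F,c)$ is isomorphic to a generated submodel of $U(n)$ contained in $U(n)_{\wedge,\to}$. 2. Let $n$ and $c:F\to\{0,1\}^n$ be any number and colouring for which there is an isomorphism $f$ of $(F,c)$ onto a generated submodel of $U(n)$ contained in $U(n)_{\wedge,\to}$, and let $\beta(F):=s(\psi_{f(r)})$, a $(\wedge,\to)$-formula. Then for every Heyting algebra $B$: there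 is an assignment $\{p_1,\dots,p_n\}\to B$ under which $\beta(F)$ does not take the value $1$ if and only if there is an injective map $A\to B$ preserving $\wedge$ and $\to$. -/

import Mathlib

namespace IPC

/-! ### Formulas and intuitionistic propositional calculus -/

/-- Propositional formulas in the variables `p₀, …, pₙ₋₁`. -/
inductive Fml (n : ℕ) : Type
  | var (i : Fin n) : Fml n
  | bot : Fml n
  | top : Fml n
  | and (φ ψ : Fml n) : Fml n
  | or (φ ψ : Fml n) : Fml n
  | imp (φ ψ : Fml n) : Fml n

/-- Meet-implication formulas. The constant `⊤`, definable as `p → p`, is kept as a primitive so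
that the empty conjunction is always available. -/
inductive MIFml (n : ℕ) : Type
  | var (i : Fin n) : MIFml n
  | top : MIFml n
  | and (φ ψ : MIFml n) : MIFml n
  | imp (φ ψ : MIFml n) : MIFml n

/-- The inclusion of meet-implication formulas into all formulas. -/
def MIFml.toFml {n : ℕ} : MIFml n → Fml n
  | .var i => .var i
  | .top => .top
  | .and φ ψ => .and φ.toFml ψ.toFml
  | .imp φ ψ => .imp φ.toFml ψ.toFml

/-- `⋀ l`, with `⋀ ∅ = ⊤`. -/
def Fml.bigAnd {n : ℕ} (l : List (Fml n)) : Fml n := l.foldr Fml.and Fml.top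

/-- `⋁ l`, with `⋁ ∅ = ⊥`. -/
def Fml.bigOr {n : ℕ} (l : List (Fml n)) : Fml n := l.foldr Fml.or Fml.bot

/-- `⋀ l`, with `⋀ ∅ = ⊤`. -/
def MIFml.bigAnd {n : ℕ} (l : List (MIFml n)) : MIFml n := l.foldr MIFml.and MIFml.top

/-- The value of a formula in a Heyting algebra under an assignment. -/
def Fml.eval {n : ℕ} {B : Type*} [HeytingAlgebra B] (a : Fin n → B) : Fml n → B
  | .var i => a i
  | .bot => ⊥
  | .top => ⊤
  | .and φ ψ => φ.eval a ⊓ ψ.eval a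
  | .or φ ψ => φ.eval a ⊔ ψ.eval a
  | .imp φ ψ => φ.eval a ⇨ ψ.eval a

/-- `B` refutes the equation `φ ≈ 1`. -/
def Refutes {n : ℕ} (B : Type*) [HeytingAlgebra B] (φ : Fml n) : Prop :=
  ∃ a : Fin n → B, φ.eval a ≠ ⊤

/-- Derivability in IPC (natural deduction). -/
inductive Derives {n : ℕ} : Set (Fml n) → Fml n → Prop
  | hyp {Γ : Set (Fml n)} {φ : Fml n} : φ ∈ Γ → Derives Γ φ
  | topI {Γ : Set (Fml n)} : Derives Γ .top
  | botE {Γ : Set (Fml n)} {φ : Fml n} : Derives Γ .bot → Derives Γ φ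
  | andI {Γ : Set (Fml n)} {φ ψ : Fml n} : Derives Γ φ → Derives Γ ψ → Derives Γ (.and φ ψ)
  | andE₁ {Γ : Set (Fml n)} {φ ψ : Fml n} : Derives Γ (.and φ ψ) → Derives Γ φ
  | andE₂ {Γ : Set (Fml n)} {φ ψ : Fml n} : Derives Γ (.and φ ψ) → Derives Γ ψ
  | orI₁ {Γ : Set (Fml n)} {φ ψ : Fml n} : Derives Γ φ → Derives Γ (.or φ ψ)
  | orI₂ {Γ : Set (Fml n)} {φ ψ : Fml n} : Derives Γ ψ → Derives Γ (.or φ ψ)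
  | orE {Γ : Set (Fml n)} {φ ψ χ : Fml n} : Derives Γ (.or φ ψ) →
      Derives (insert φ Γ) χ → Derives (insert ψ Γ) χ → Derives Γ χ
  | impI {Γ : Set (Fml n)} {φ ψ : Fml n} : Derives (insert φ Γ) ψ → Derives Γ (.imp φ ψ)
  | impE {Γ : Set (Fml n)} {φ ψ : Fml n} :
      Derives Γ (.imp φ ψ) → Derives Γ φ → Derives Γ ψ

theorem Derives.mono {n : ℕ} {Γ : Set (Fml n)} {φ : Fml n} (h : Derives Γ φ) :
    ∀ {Δ : Set (Fml n)}, Γ ⊆ Δ → Derives Δ φ := by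
  induction h with
  | hyp h => exact fun s => .hyp (s h)
  | topI => exact fun _ => .topI
  | botE _ ih => exact fun s => .botE (ih s)
  | andI _ _ ih₁ ih₂ => exact fun s => .andI (ih₁ s) (ih₂ s)
  | andE₁ _ ih => exact fun s => .andE₁ (ih s)
  | andE₂ _ ih => exact fun s => .andE₂ (ih s)
  | orI₁ _ ih => exact fun s => .orI₁ (ih s)
  | orI₂ _ ih => exact fun s => .orI₂ (ih s)
  | orE _ _ _ ih₁ ih₂ ih₃ =>
    exact fun s => .orE (ih₁ s) (ih₂ (Set.insert_subset_insert s))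
      (ih₃ (Set.insert_subset_insert s))
  | impI _ ih => exact fun s => .impI (ih (Set.insert_subset_insert s))
  | impE _ _ ih₁ ih₂ => exact fun s => .impE (ih₁ s) (ih₂ s)

theorem Derives.cut {n : ℕ} {φ ψ χ : Fml n} (h₁ : Derives {φ} ψ) (h₂ : Derives {ψ} χ) :
    Derives {φ} χ :=
  .impE (.impI (h₂.mono (by simp))) h₁

/-! ### The free implicative meet-semilattice and the translation `s` -/

/-- Provable equivalence of meet-implication formulas. -/
def miSetoid (n : ℕ) : Setoid (MIFml n) where
  r φ ψ := Derives {φ.toFml} ψ.toFml ∧ Derives {ψ.toFml} φ.toFml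
  iseqv :=
    { refl := fun _ => ⟨.hyp rfl, .hyp rfl⟩
      symm := fun h => ⟨h.2, h.1⟩
      trans := fun h k => ⟨h.1.cut k.1, k.2.cut h.2⟩ }

/-- The (carrier of the) free implicative meet-semilattice on `n` generators: the
meet-implication fragment of the Lindenbaum algebra of IPC. -/
def FreeMI (n : ℕ) : Type := Quotient (miSetoid n)

/-- A chosen representing formula of an element of `FreeMI n`. -/
noncomputable def FreeMI.rep {n : ℕ} (a : FreeMI n) : MIFml n := Quotient.out a

/-- The order of `FreeMI n`. It is independent of the representatives. -/
def FreeMI.le {n : ℕ} (a b : FreeMI n) : Prop := Derives {a.rep.toFml} b.rep.toFml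

open Classical in
/-- The meet of a finite subset of `FreeMI n`, as a formula. `FreeMI n` is a finite set by Diego's
theorem, so the second branch never occurs. -/
noncomputable def FreeMI.meet {n : ℕ} (S : Set (FreeMI n)) : MIFml n :=
  if h : S.Finite then MIFml.bigAnd (h.toFinset.toList.map FreeMI.rep) else MIFml.top

/-- The binary supremum of the finite lattice `FreeMI n`:
`φ ⊻ ψ = ⋀ {χ ∈ FreeMI n | φ ≤ χ and ψ ≤ χ}`. -/
noncomputable def MIFml.veebar {n : ℕ} (φ ψ : MIFml n) : MIFml n :=
  FreeMI.meet {χ : FreeMI n | FreeMI.le (Quotient.mk (miSetoid n) φ) χ ∧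
    FreeMI.le (Quotient.mk (miSetoid n) ψ) χ}

/-- The bottom element `p₀ ∧ ⋯ ∧ pₙ₋₁` of `FreeMI n`. -/
def MIFml.botMI (n : ℕ) : MIFml n := MIFml.bigAnd ((List.finRange n).map MIFml.var)

/-- The translation `s`, replacing `∨` by `⊻` and `⊥` by `p₀ ∧ ⋯ ∧ pₙ₋₁`. -/
noncomputable def Fml.s {n : ℕ} : Fml n → MIFml n
  | .var i => .var i
  | .bot => MIFml.botMI n
  | .top => .top
  | .and φ ψ => .and φ.s ψ.s
  | .or φ ψ => MIFml.veebar φ.s ψ.s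
  | .imp φ ψ => .imp φ.s ψ.s

/-! ### Models

A model on a poset `X` with `n` variables is given by its colouring, an order-preserving map
`c : X →o (Fin n → Prop)`. -/

/-- `x` is a `q`-border point: `q` fails at `x` and holds at all proper successors of `x`. -/
def IsBorder {n : ℕ} {X : Type*} [PartialOrder X] (c : X →o (Fin n → Prop)) (q : Fin n) (x : X) :
    Prop :=
  ¬ c x q ∧ ∀ y, x < y → c y q

/-- Separated points of a model. -/
def IsSeparated {n : ℕ} {X : Type*} [PartialOrder X] (c : X →o (Fin n → Prop)) (x : X) : Prop :=
  ∃ q, IsBorder c q x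

/-- The colouring of the submodel of separated points. -/
def sepColour {n : ℕ} {X : Type*} [PartialOrder X] (c : X →o (Fin n → Prop)) :
    {x : X // IsSeparated c x} →o (Fin n → Prop) :=
  c.comp (OrderHom.Subtype.val _)

/-- A p-morphism of frames is a p-morphism of models if it preserves colours. -/
def PreservesColour {n : ℕ} {X Y : Type*} (c : X → Fin n → Prop) (d : Y → Fin n → Prop)
    (f : X → Y) : Prop :=
  ∀ x, d (f x) = c x

/-! ### The canonical and the universal model -/

/-- The canonical frame `C(n)`: theories with the disjunction property, i.e. prime filters of the
Lindenbaum algebra of IPC in `n` variables. -/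
@[ext]
structure Canonical (n : ℕ) : Type where
  carrier : Set (Fml n)
  closed : ∀ φ, Derives carrier φ → φ ∈ carrier
  bot_notMem : Fml.bot ∉ carrier
  prime : ∀ φ ψ, Fml.or φ ψ ∈ carrier → φ ∈ carrier ∨ ψ ∈ carrier

/-- Theories are ordered by inclusion. -/
instance (n : ℕ) : PartialOrder (Canonical n) :=
  PartialOrder.lift Canonical.carrier fun _ _ h => Canonical.ext h

/-- The universal model `U(n)`: the image-finite part of the canonical model. -/
def Universal (n : ℕ) : Type := {x : Canonical n // (Set.Ici x).Finite}

instance (n : ℕ) : PartialOrder (Universal n) := Subtype.partialOrder _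

/-- The colouring of `U(n)`. -/
def uColour (n : ℕ) : Universal n →o (Fin n → Prop) where
  toFun w i := Fml.var i ∈ w.1.carrier
  monotone' := fun _ _ h _ hi => h hi

/-- `U(n)` restricted to the meet-implication fragment: the image of the (unique) p-morphism of
models from the submodel of separated points of `U(n)` to `U(n)`. -/
def universalMI (n : ℕ) : Set (Universal n) :=
  {w | ∃ f : PseudoEpimorphism {x : Universal n // IsSeparated (uColour n) x} (Universal n),
    PreservesColour (sepColour (uColour n)) (uColour n) f ∧ w ∈ Set.range f}

theorem Universal.finite_Ici {n : ℕ} (w : Universal n) : (Set.Ici w).Finite :=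
  Set.Finite.of_finite_image (f := Subtype.val)
    (w.2.subset (by rintro _ ⟨v, hv, rfl⟩; exact hv)) Subtype.val_injective.injOn

/-- The set of immediate successors of `w`. -/
noncomputable def Universal.immSucc {n : ℕ} (w : Universal n) : Finset (Universal n) :=
  (w.finite_Ici.subset (fun _ h => le_of_lt h.1) : {w' | w ⋖ w'}.Finite).toFinset

theorem Universal.lt_of_mem_immSucc {n : ℕ} {w v : Universal n} (h : v ∈ w.immSucc) : w < v := by
  have h' : w ⋖ v := by simpa [Universal.immSucc] using h
  exact h'.lt

theorem Universal.card_lt_of_mem_immSucc {n : ℕ} {w v : Universal n} (h : v ∈ w.immSucc) :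
    (Set.Ici v).ncard < (Set.Ici w).ncard :=
  Set.ncard_lt_ncard (Set.Ici_ssubset_Ici.2 (lt_of_mem_immSucc h)) w.finite_Ici

/-! ### De Jongh formulas -/

open Classical in
/-- The pair `(φ_w, θ_w)` of formulas of a point `w` of `U(n)`, by recursion on the number of
successors of `w`. With `ψ_w = φ_w → θ_w`, the formulas are
`θ_w = ⋁ {φ_{w'} | w' immediate successor of w}` and
`φ_w = ⋀ {p | p true at w} ∧ ⋀ {q → θ_w | w is a q-border point}
  ∧ ⋀ {ψ_{w'} → θ_w | w' immediate successor of w}`. -/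
noncomputable def phiTheta {n : ℕ} (w : Universal n) : Fml n × Fml n :=
  let θ : Fml n := Fml.bigOr (w.immSucc.attach.toList.map fun w' => (phiTheta w'.1).1)
  (.and (Fml.bigAnd ((Finset.univ.filter fun p => uColour n w p).toList.map Fml.var))
    (.and
      (Fml.bigAnd ((Finset.univ.filter fun q => IsBorder (uColour n) q w).toList.map
        fun q => .imp (.var q) θ))
      (Fml.bigAnd (w.immSucc.attach.toList.map
        fun w' => .imp (.imp (phiTheta w'.1).1 (phiTheta w'.1).2) θ))), θ)
termination_by (Set.Ici w).ncard
decreasing_by all_goals exact Universal.card_lt_of_mem_immSucc w'.2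

/-- The de Jongh formula `φ_w`. -/
noncomputable def phi {n : ℕ} (w : Universal n) : Fml n := (phiTheta w).1

/-- The de Jongh formula `θ_w`. -/
noncomputable def theta {n : ℕ} (w : Universal n) : Fml n := (phiTheta w).2

/-- The de Jongh formula `ψ_w = φ_w → θ_w`. -/
noncomputable def psi {n : ℕ} (w : Universal n) : Fml n := .imp (phi w) (theta w)

/-! ### Subframe formulas -/

/-- `f` is an isomorphism of the model `(F, c)` onto a generated submodel of `universalMI n`. -/
structure IsGenSubmodelIso {n : ℕ} {F : Type*} [PartialOrder F] (c : F →o (Fin n → Prop))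
    (f : F ↪o Universal n) : Prop where
  colour : PreservesColour c (uColour n) f
  upper : IsUpperSet (Set.range f)
  subset : Set.range f ⊆ universalMI n

/-- The colouring of a frame enumerated as `x₀, …, xₙ₋₁` in which `p_j` is true at `x` if and only
if `x ≰ x_j`. -/
def stdColour {n : ℕ} {F : Type*} [PartialOrder F] (e : Fin n ≃ F) : F →o (Fin n → Prop) where
  toFun x j := ¬ x ≤ e j
  monotone' := fun _ _ h _ hx hy => hx (h.trans hy)

/-- The subframe formula `β(F) = s(ψ_w) = s(φ_w) → s(θ_w)`, where `w` is the image in `U(n)` of the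
root `r` of `F`. -/
noncomputable def subframeFormula {n : ℕ} {F : Type*} [PartialOrder F] (f : F ↪o Universal n)
    (r : F) : MIFml n :=
  (psi (f r)).s

/-- The Heyting algebra of up-sets of `F`, ordered by inclusion (Mathlib orders `UpperSet F` by
reverse inclusion). -/
abbrev UpAlg (F : Type*) [PartialOrder F] : Type _ := (UpperSet F)ᵒᵈ

/-- There is an injective map `A → B` preserving `∧` and `→`. -/
def MIEmbeds (A B : Type*) [HeytingAlgebra A] [HeytingAlgebra B] : Prop :=
  ∃ g : A → B, Function.Injective g ∧ (∀ a b, g (a ⊓ b) = g a ⊓ g b) ∧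
    ∀ a b, g (a ⇨ b) = g a ⇨ g b

end IPC

/-! The set `universalMI n` is the largest up-set of U(n) consisting of separated points. The proof
rests on two of its properties.

Completeness (`derives_toFml_of_forall`): an underivable entailment between meet-implication
formulas fails at a point of `universalMI n`. A meet-implication theory maximal among those omitting
`q` is a `q`-border point, so colours increase strictly along inclusion and there are only finitely
many such theories. They form a finite model of separated points, which maps into `universalMI n`;
Diego's theorem follows as well.

Definability (`exists_force_iff_not_le`): the meet-implication theory of a point of `universalMI n`
determines its full theory, so some meet-implication formula defines the complement of each
principal down-set. Hence `⊻` acts there as disjunction, `s` preserves truth, and β(F) holds exactly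
at the points not below `f r`.

If A embeds in B, the valuation of F in A refutes β(F) at `r`, and the embedding carries this to B.
Conversely, given a refutation in B, send an up-set U to the value of the formula defining the
points not below any `f x` with `x ∉ U`. The identities for ∧ and → hold on `universalMI n`, hence
in B by completeness. The largest proper up-set goes to the value of β(F), which is not 1, and since
F is rooted this forces injectivity.

For the standard colouring, `x_j` is a `p_j`-border point and the variables recover the order, so
the theory map is an embedding into `universalMI n`. -/

namespace IPC

variable {n : ℕ}

/-! ### Kripke semantics -/

/-- Kripke forcing of a formula at a point of a model. -/
def Force {X : Type*} [PartialOrder X] (c : X →o (Fin n → Prop)) : Fml n → X → Prop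
  | .var i, x => c x i
  | .bot, _ => False
  | .top, _ => True
  | .and φ ψ, x => Force c φ x ∧ Force c ψ x
  | .or φ ψ, x => Force c φ x ∨ Force c ψ x
  | .imp φ ψ, x => ∀ y, x ≤ y → Force c φ y → Force c ψ y

section Force

variable {X Y : Type*} [PartialOrder X] [PartialOrder Y] {c : X →o (Fin n → Prop)}
  {d : Y →o (Fin n → Prop)}

theorem Force.mono {φ : Fml n} {x y : X} (h : x ≤ y) (hx : Force c φ x) : Force c φ y := by
  induction φ with
  | var i => exact c.monotone h i hx
  | bot => exact hx
  | top => trivial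
  | and φ ψ ih₁ ih₂ => exact ⟨ih₁ hx.1, ih₂ hx.2⟩
  | or φ ψ ih₁ ih₂ => exact hx.imp ih₁ ih₂
  | imp φ ψ _ _ => exact fun z hz => hx z (h.trans hz)

theorem force_bigAnd {l : List (Fml n)} {x : X} :
    Force c (Fml.bigAnd l) x ↔ ∀ φ ∈ l, Force c φ x := by
  induction l with
  | nil => simp [Fml.bigAnd, Force]
  | cons φ l ih =>
    rw [List.forall_mem_cons, ← ih]
    rfl

theorem force_bigOr {l : List (Fml n)} {x : X} :
    Force c (Fml.bigOr l) x ↔ ∃ φ ∈ l, Force c φ x := by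
  induction l with
  | nil => simp [Fml.bigOr, Force]
  | cons φ l ih =>
    rw [List.exists_mem_cons_iff, ← ih]
    rfl

theorem Derives.force {Γ : Set (Fml n)} {φ : Fml n} (h : Derives Γ φ) :
    ∀ x : X, (∀ γ ∈ Γ, Force c γ x) → Force c φ x := by
  induction h with
  | hyp h => exact fun x hx => hx _ h
  | topI => exact fun _ _ => trivial
  | botE _ ih => exact fun x hx => (ih x hx).elim
  | andI _ _ ih₁ ih₂ => exact fun x hx => ⟨ih₁ x hx, ih₂ x hx⟩
  | andE₁ _ ih => exact fun x hx => (ih x hx).1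
  | andE₂ _ ih => exact fun x hx => (ih x hx).2
  | orI₁ _ ih => exact fun x hx => .inl (ih x hx)
  | orI₂ _ ih => exact fun x hx => .inr (ih x hx)
  | orE _ _ _ ih₁ ih₂ ih₃ =>
    intro x hx
    rcases ih₁ x hx with h | h
    · exact ih₂ x (Set.forall_mem_insert.2 ⟨h, hx⟩)
    · exact ih₃ x (Set.forall_mem_insert.2 ⟨h, hx⟩)
  | impI _ ih =>
    exact fun x hx y hy h => ih y (Set.forall_mem_insert.2 ⟨h, fun γ hγ => (hx γ hγ).mono hy⟩)
  | impE _ _ ih₁ ih₂ => exact fun x hx => ih₁ x hx x le_rfl (ih₂ x hx)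

/-- Bisimilar points force the same formulas. -/
theorem force_iff_of_bisim (R : X → Y → Prop) (hc : ∀ x y, R x y → d y = c x)
    (forth : ∀ x y, R x y → ∀ x', x ≤ x' → ∃ y', y ≤ y' ∧ R x' y')
    (back : ∀ x y, R x y → ∀ y', y ≤ y' → ∃ x', x ≤ x' ∧ R x' y') (φ : Fml n) :
    ∀ x y, R x y → (Force c φ x ↔ Force d φ y) := by
  induction φ with
  | var i => exact fun x y h => by simp only [Force, hc x y h]
  | bot => exact fun _ _ _ => Iff.rfl
  | top => exact fun _ _ _ => Iff.rfl
  | and φ ψ ih₁ ih₂ => exact fun x y h => and_congr (ih₁ x y h) (ih₂ x y h)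
  | or φ ψ ih₁ ih₂ => exact fun x y h => or_congr (ih₁ x y h) (ih₂ x y h)
  | imp φ ψ ih₁ ih₂ =>
    refine fun x y h => ⟨fun hx y' hy' hφ => ?_, fun hy x' hx' hφ => ?_⟩
    · obtain ⟨x', hx', h'⟩ := back x y h y' hy'
      exact (ih₂ x' y' h').1 (hx x' hx' ((ih₁ x' y' h').2 hφ))
    · obtain ⟨y', hy', h'⟩ := forth x y h x' hx'
      exact (ih₂ x' y' h').2 (hy y' hy' ((ih₁ x' y' h').1 hφ))

/-- Maps of models that are p-morphisms preserve forcing. -/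
theorem force_map_iff {f : X → Y} (hf : Monotone f) (hc : PreservesColour c d f)
    (back : ∀ x y, f x ≤ y → ∃ x', x ≤ x' ∧ f x' = y) (φ : Fml n) (x : X) :
    Force d φ (f x) ↔ Force c φ x := by
  refine (force_iff_of_bisim (fun x y => f x = y) ?_ ?_ ?_ φ x _ rfl).symm
  · rintro x _ rfl
    exact hc x
  · rintro x _ rfl x' h
    exact ⟨_, hf h, rfl⟩
  · rintro x _ rfl y h
    exact back x y h

/-- Forcing at a point is determined by its colour and its proper successors. -/
theorem force_iff_of_Ioi_eq {x y : X} (hc : c x = c y) (h : Set.Ioi x = Set.Ioi y) (φ : Fml n) :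
    Force c φ x ↔ Force c φ y := by
  refine force_iff_of_bisim (fun a b => a = b ∨ a = x ∧ b = y) ?_ ?_ ?_ φ x y (.inr ⟨rfl, rfl⟩)
  · rintro a b (rfl | ⟨rfl, rfl⟩)
    exacts [rfl, hc.symm]
  · rintro a b (rfl | ⟨rfl, rfl⟩) z hz
    · exact ⟨z, hz, .inl rfl⟩
    · rcases hz.eq_or_lt with rfl | hz
      · exact ⟨b, le_rfl, .inr ⟨rfl, rfl⟩⟩
      · have : z ∈ Set.Ioi b := h ▸ hz
        exact ⟨z, this.le, .inl rfl⟩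
  · rintro a b (rfl | ⟨rfl, rfl⟩) z hz
    · exact ⟨z, hz, .inl rfl⟩
    · rcases hz.eq_or_lt with rfl | hz
      · exact ⟨a, le_rfl, .inr ⟨rfl, rfl⟩⟩
      · have : z ∈ Set.Ioi a := h ▸ hz
        exact ⟨z, this.le, .inl rfl⟩

end Force

/-! ### Derivability -/

theorem Derives.finite_support {Γ : Set (Fml n)} {φ : Fml n} (h : Derives Γ φ) :
    ∃ Δ ⊆ Γ, Δ.Finite ∧ Derives Δ φ := by
  -- A discharged hypothesis may or may not occur in the finite support; removing it and inserting
  -- it again covers both cases.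
  have insert_aux : ∀ {Γ Δ : Set (Fml n)} {φ ψ : Fml n}, Δ ⊆ insert φ Γ → Derives Δ ψ →
      Derives (insert φ (Δ \ {φ})) ψ ∧ Δ \ {φ} ⊆ Γ := by
    intro Γ Δ φ ψ hs h
    refine ⟨h.mono fun x hx => ?_, fun x hx => (hs hx.1).resolve_left hx.2⟩
    by_cases hxφ : x = φ
    · exact .inl hxφ
    · exact .inr ⟨hx, hxφ⟩
  induction h with
  | hyp h => exact ⟨_, Set.singleton_subset_iff.2 h, Set.finite_singleton _, .hyp rfl⟩
  | topI => exact ⟨∅, Set.empty_subset _, Set.finite_empty, .topI⟩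
  | botE _ ih => obtain ⟨Δ, h, hf, hd⟩ := ih; exact ⟨Δ, h, hf, .botE hd⟩
  | andI _ _ ih₁ ih₂ =>
    obtain ⟨Δ, h, hf, hd⟩ := ih₁
    obtain ⟨Δ', h', hf', hd'⟩ := ih₂
    exact ⟨Δ ∪ Δ', Set.union_subset h h', hf.union hf',
      .andI (hd.mono Set.subset_union_left) (hd'.mono Set.subset_union_right)⟩
  | andE₁ _ ih => obtain ⟨Δ, h, hf, hd⟩ := ih; exact ⟨Δ, h, hf, .andE₁ hd⟩
  | andE₂ _ ih => obtain ⟨Δ, h, hf, hd⟩ := ih; exact ⟨Δ, h, hf, .andE₂ hd⟩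
  | orI₁ _ ih => obtain ⟨Δ, h, hf, hd⟩ := ih; exact ⟨Δ, h, hf, .orI₁ hd⟩
  | orI₂ _ ih => obtain ⟨Δ, h, hf, hd⟩ := ih; exact ⟨Δ, h, hf, .orI₂ hd⟩
  | orE _ _ _ ih₁ ih₂ ih₃ =>
    obtain ⟨Δ, h, hf, hd⟩ := ih₁
    obtain ⟨Δ', h', hf', hd'⟩ := ih₂
    obtain ⟨Δ'', h'', hf'', hd''⟩ := ih₃
    obtain ⟨e', s'⟩ := insert_aux h' hd'
    obtain ⟨e'', s''⟩ := insert_aux h'' hd''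
    refine ⟨Δ ∪ (Δ' \ {_} ∪ Δ'' \ {_}), Set.union_subset h (Set.union_subset s' s''),
      hf.union (hf'.sdiff.union hf''.sdiff), .orE (hd.mono Set.subset_union_left)
      (e'.mono (Set.insert_subset_insert ?_)) (e''.mono (Set.insert_subset_insert ?_))⟩
    · exact Set.subset_union_left.trans Set.subset_union_right
    · exact Set.subset_union_right.trans Set.subset_union_right
  | impI _ ih =>
    obtain ⟨Δ, h, hf, hd⟩ := ih
    obtain ⟨e, s⟩ := insert_aux h hd
    exact ⟨_, s, hf.sdiff, .impI e⟩
  | impE _ _ ih₁ ih₂ =>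
    obtain ⟨Δ, h, hf, hd⟩ := ih₁
    obtain ⟨Δ', h', hf', hd'⟩ := ih₂
    exact ⟨Δ ∪ Δ', Set.union_subset h h', hf.union hf',
      .impE (hd.mono Set.subset_union_left) (hd'.mono Set.subset_union_right)⟩

/-- Lindenbaum's lemma, relative to a map `e` from a set of formulas into all formulas. -/
theorem exists_maximal_not_derives {L : Type*} (e : L → Fml n) {Γ : Set L} {φ : Fml n}
    (h : ¬ Derives (e '' Γ) φ) :
    ∃ Δ, Γ ⊆ Δ ∧ ¬ Derives (e '' Δ) φ ∧ ∀ ψ ∉ Δ, Derives (e '' insert ψ Δ) φ := by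
  obtain ⟨Δ, hΓ, hΔ⟩ := zorn_subset_nonempty {Δ : Set L | ¬ Derives (e '' Δ) φ} (by
    intro C hC hchain hne
    refine ⟨⋃₀ C, fun hd => ?_, fun _ => Set.subset_sUnion_of_mem⟩
    obtain ⟨Θ, hs, hfin, hd⟩ := hd.finite_support
    obtain ⟨T, hT, hTfin, rfl⟩ := (Set.exists_subset_image_finite_and
      (p := fun s => s = Θ)).1 ⟨Θ, hs, hfin, rfl⟩
    obtain ⟨Δ, hΔ, hTΔ⟩ :=
      hchain.directedOn.exists_mem_subset_of_finite_of_subset_sUnion hne hTfin hT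
    exact hC hΔ (hd.mono (Set.image_mono hTΔ))) Γ h
  refine ⟨Δ, hΓ, hΔ.prop, fun ψ hψ => ?_⟩
  by_contra hd
  exact hψ (hΔ.le_of_ge hd (Set.subset_insert ψ Δ) (Set.mem_insert ψ Δ))

/-- The prime extension theorem. -/
theorem exists_canonical {Γ : Set (Fml n)} {φ : Fml n} (h : ¬ Derives Γ φ) :
    ∃ v : Canonical n, Γ ⊆ v.carrier ∧ φ ∉ v.carrier := by
  obtain ⟨Δ, hΓ, hφ, hmax⟩ := exists_maximal_not_derives id (Γ := Γ) (by simpa using h)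
  simp only [Set.image_id] at hφ hmax
  have closed : ∀ ψ, Derives Δ ψ → ψ ∈ Δ := fun ψ hψ => by
    by_contra hn
    exact hφ (.impE (.impI (hmax ψ hn)) hψ)
  refine ⟨⟨Δ, closed, fun hb => hφ (.botE (.hyp hb)), fun ψ χ hor => ?_⟩, hΓ,
    fun hm => hφ (.hyp hm)⟩
  by_contra! hn
  exact hφ (.orE (.hyp hor) (hmax ψ hn.1) (hmax χ hn.2))

theorem Canonical.imp_mem_iff {v : Canonical n} {φ ψ : Fml n} :
    Fml.imp φ ψ ∈ v.carrier ↔ ∀ u, v ≤ u → φ ∈ u.carrier → ψ ∈ u.carrier := by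
  refine ⟨fun h u hu hφ => u.closed _ (.impE (.hyp (hu h)) (.hyp hφ)), fun h => ?_⟩
  by_contra hn
  obtain ⟨u, hu, hψ⟩ := exists_canonical (Γ := insert φ v.carrier) (φ := ψ)
    fun hd => hn (v.closed _ (.impI hd))
  exact hψ (h u (fun _ hx => hu (Set.mem_insert_of_mem _ hx)) (hu (Set.mem_insert _ _)))

namespace Universal

/-- The point of `U(n)` given by a point of `C(n)` above a point of `U(n)`. -/
def ofLE (w : Universal n) (v : Canonical n) (h : w.1 ≤ v) : Universal n :=
  ⟨v, w.2.subset fun _ hu => le_trans h hu⟩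

/-- The truth lemma for `U(n)`. -/
theorem force_iff {φ : Fml n} {w : Universal n} :
    Force (uColour n) φ w ↔ φ ∈ w.1.carrier := by
  induction φ generalizing w with
  | var i => exact Iff.rfl
  | bot => exact ⟨False.elim, w.1.bot_notMem⟩
  | top => exact ⟨fun _ => w.1.closed _ .topI, fun _ => trivial⟩
  | and φ ψ ih₁ ih₂ =>
    simp only [Force, ih₁, ih₂]
    exact ⟨fun h => w.1.closed _ (.andI (.hyp h.1) (.hyp h.2)),
      fun h => ⟨w.1.closed _ (.andE₁ (.hyp h)), w.1.closed _ (.andE₂ (.hyp h))⟩⟩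
  | or φ ψ ih₁ ih₂ =>
    simp only [Force, ih₁, ih₂]
    exact ⟨fun h => w.1.closed _ (h.elim (fun h => .orI₁ (.hyp h)) fun h => .orI₂ (.hyp h)),
      w.1.prime _ _⟩
  | imp φ ψ ih₁ ih₂ =>
    simp only [Force, ih₁, ih₂, Canonical.imp_mem_iff]
    exact ⟨fun h u hu => h (w.ofLE u hu) hu, fun h u hu => h u.1 hu⟩

theorem ext_force {v w : Universal n}
    (h : ∀ φ, Force (uColour n) φ v ↔ Force (uColour n) φ w) : v = w :=
  Subtype.ext (Canonical.ext (Set.ext fun φ => by rw [← force_iff, ← force_iff, h]))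

end Universal

/-! ### The map from an image-finite model to the universal model -/

section TheoryMap

variable {X : Type*} [PartialOrder X] (c : X →o (Fin n → Prop))

/-- The theory of a point of a model. -/
def theoryAt (x : X) : Canonical n where
  carrier := {φ | Force c φ x}
  closed _ h := h.force x fun _ => id
  bot_notMem := id
  prime _ _ := id

variable {c}

/-- Choosing one witness per point of a finite set lets finite conjunctions and disjunctions stand
in for infinite theories. -/
theorem exists_list_of_finite {L Y : Type*} {s : Set Y} (hs : s.Finite) (P : L → Prop)
    (Q : L → Y → Prop) : ∃ l : List L, (∀ φ ∈ l, P φ) ∧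
      ∀ y ∈ s, (∃ φ, P φ ∧ Q φ y) → ∃ φ ∈ l, Q φ y := by
  classical
  choose g hg using fun y : {y // ∃ φ, P φ ∧ Q φ y} => y.2
  have hfin : (g '' {y | y.1 ∈ s}).Finite :=
    (Set.Finite.of_finite_image (f := Subtype.val)
      (hs.subset (by rintro _ ⟨y, hy, rfl⟩; exact hy)) Subtype.val_injective.injOn).image g
  refine ⟨hfin.toFinset.toList, fun φ hφ => ?_, fun y hy h => ⟨g ⟨y, h⟩, ?_, (hg ⟨y, h⟩).2⟩⟩
  · rw [Finset.mem_toList, Set.Finite.mem_toFinset] at hφ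
    obtain ⟨y, -, rfl⟩ := hφ
    exact (hg y).1
  · rw [Finset.mem_toList, Set.Finite.mem_toFinset]
    exact ⟨⟨y, h⟩, hy, rfl⟩

/-- The back condition for `theoryMap`. If T differed from the theories of the finitely many points
above `x`, a finite `⋀ l → ⋁ m` with `l` inside T and `m` outside it would hold at `x`, hence lie in
T, against primality. -/
theorem exists_theoryAt_eq {x : X} (hx : (Set.Ici x).Finite) {T : Canonical n}
    (hT : theoryAt c x ≤ T) : ∃ y, x ≤ y ∧ theoryAt c y = T := by
  by_contra! hne
  have key : ∀ y, x ≤ y → (∃ φ ∈ T.carrier, ¬ Force c φ y) ∨ ∃ ψ, ψ ∉ T.carrier ∧ Force c ψ y := by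
    intro y hy
    by_contra! h
    exact hne y hy (Canonical.ext (Set.Subset.antisymm (fun φ hφ => by
      by_contra hn
      exact h.2 φ hn hφ) h.1))
  obtain ⟨l, hl, hl'⟩ := exists_list_of_finite hx (fun φ => φ ∈ T.carrier)
    fun φ y => ¬ Force c φ y
  obtain ⟨m, hm, hm'⟩ := exists_list_of_finite hx (fun φ => φ ∉ T.carrier)
    fun φ y => Force c φ y
  have h₁ : Fml.imp (Fml.bigAnd l) (Fml.bigOr m) ∈ T.carrier := hT fun y hy hφ => by
    rw [force_bigAnd] at hφ
    rw [force_bigOr]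
    refine hm' y hy ((key y hy).resolve_left fun h => ?_)
    obtain ⟨φ, hφl, hn⟩ := hl' y hy h
    exact hn (hφ φ hφl)
  have h₂ : ∀ l : List (Fml n), (∀ φ ∈ l, φ ∈ T.carrier) → Fml.bigAnd l ∈ T.carrier := by
    intro l hl
    induction l with
    | nil => exact T.closed _ .topI
    | cons φ l ih =>
      rw [List.forall_mem_cons] at hl
      exact T.closed _ (.andI (.hyp hl.1) (.hyp (ih hl.2)))
  have h₃ : ∀ m : List (Fml n), (∀ φ ∈ m, φ ∉ T.carrier) → Fml.bigOr m ∉ T.carrier := by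
    intro m hm
    induction m with
    | nil => exact T.bot_notMem
    | cons φ m ih =>
      rw [List.forall_mem_cons] at hm
      exact fun h => (T.prime _ _ h).elim hm.1 (ih hm.2)
  exact h₃ m hm (T.closed _ (.impE (.hyp h₁) (.hyp (h₂ l hl))))

variable (c)

/-- The p-morphism of models from an image-finite model to the universal model. -/
def theoryMap (hX : ∀ x : X, (Set.Ici x).Finite) : PseudoEpimorphism X (Universal n) where
  toFun x := ⟨theoryAt c x, ((hX x).image (theoryAt c)).subset fun _ hT =>
    let ⟨y, hy, h⟩ := exists_theoryAt_eq (hX x) hT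
    ⟨y, hy, h⟩⟩
  monotone' _ _ h _ hφ := Force.mono h hφ
  exists_map_eq_of_map_le' x T hT :=
    let ⟨y, hy, h⟩ := exists_theoryAt_eq (hX x) (T := T.1) hT
    ⟨y, hy, Subtype.ext h⟩

variable {c}

theorem mem_theoryMap {hX : ∀ x : X, (Set.Ici x).Finite} {x : X} {φ : Fml n} :
    φ ∈ (theoryMap c hX x).1.carrier ↔ Force c φ x := Iff.rfl

theorem preservesColour_theoryMap {hX : ∀ x : X, (Set.Ici x).Finite} :
    PreservesColour c (uColour n) (theoryMap c hX) := fun _ => rfl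

/-- The image of a border point under a p-morphism of models is a border point. -/
theorem IsBorder.map {Y : Type*} [PartialOrder Y] {d : Y →o (Fin n → Prop)}
    {f : PseudoEpimorphism X Y} (hf : PreservesColour c d f) {q : Fin n} {x : X}
    (hx : IsBorder c q x) : IsBorder d q (f x) := by
  refine ⟨by rw [hf]; exact hx.1, fun y hy => ?_⟩
  obtain ⟨z, hz, rfl⟩ := f.exists_map_eq_of_map_le' hy.le
  rw [show f.toFun z = f z from rfl, hf]
  exact hx.2 z (hz.lt_of_ne (by rintro rfl; exact hy.ne rfl))

end TheoryMap

theorem IsBorder.val {q : Fin n} {x : {x : Universal n // IsSeparated (uColour n) x}}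
    (h : IsBorder (uColour n) q x.1) : IsBorder (sepColour (uColour n)) q x :=
  ⟨h.1, fun y hy => h.2 y.1 hy⟩

/-- `universalMI n` is the largest generated submodel of `U(n)` all of whose points are
separated. -/
theorem mem_universalMI_iff {w : Universal n} :
    w ∈ universalMI n ↔ ∀ v, w ≤ v → IsSeparated (uColour n) v := by
  constructor
  · rintro ⟨f, hf, x, rfl⟩ v hv
    obtain ⟨y, -, rfl⟩ := f.exists_map_eq_of_map_le' hv
    obtain ⟨q, hq⟩ := y.2
    exact ⟨q, hq.val.map hf⟩
  · intro hw
    refine ⟨theoryMap (sepColour (uColour n)) fun x =>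
      Set.Finite.of_finite_image (x.1.finite_Ici.subset ?_) Subtype.val_injective.injOn,
      preservesColour_theoryMap, ⟨w, hw w le_rfl⟩, ?_⟩
    · rintro _ ⟨y, hy, rfl⟩
      exact hy
    · refine Subtype.ext (Canonical.ext (Set.ext fun φ => ?_))
      rw [mem_theoryMap, ← Universal.force_iff]
      -- Above `w` all points are separated, so passing to the separated submodel loses no
      -- successors.
      refine force_iff_of_bisim (fun a b => a.1 = b ∧ w ≤ b) ?_ ?_ ?_ φ _ w ⟨rfl, le_rfl⟩
      · rintro a _ ⟨rfl, -⟩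
        rfl
      · rintro a _ ⟨rfl, h⟩ a' ha'
        exact ⟨a'.1, ha', rfl, h.trans ha'⟩
      · rintro a _ ⟨rfl, h⟩ b hb
        exact ⟨⟨b, hw b (h.trans hb)⟩, hb, rfl, h.trans hb⟩

theorem isUpperSet_universalMI : IsUpperSet (universalMI n) := fun _ _ h hw => by
  rw [mem_universalMI_iff] at hw ⊢
  exact fun u hu => hw u (h.trans hu)

/-! ### Meet-implication theories -/

/-- A theory of meet-implication formulas that is maximal among those omitting some variable. -/
@[ext]
structure MaxTheory (n : ℕ) : Type where
  carrier : Set (MIFml n)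
  closed : ∀ φ, Derives (MIFml.toFml '' carrier) φ.toFml → φ ∈ carrier
  maximal : ∃ q, MIFml.var q ∉ carrier ∧ ∀ φ ∉ carrier, MIFml.imp φ (.var q) ∈ carrier

namespace MaxTheory

instance (n : ℕ) : PartialOrder (MaxTheory n) :=
  PartialOrder.lift MaxTheory.carrier fun _ _ h => MaxTheory.ext h

/-- The colouring of the model of maximal theories. -/
def colour (n : ℕ) : MaxTheory n →o (Fin n → Prop) where
  toFun T i := MIFml.var i ∈ T.carrier
  monotone' := fun _ _ h _ hi => h hi

theorem mem_of_derives (T : MaxTheory n) {φ ψ : MIFml n} (hφ : φ ∈ T.carrier)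
    (h : Derives {φ.toFml} ψ.toFml) : ψ ∈ T.carrier :=
  T.closed _ (h.mono (Set.singleton_subset_iff.2 ⟨φ, hφ, rfl⟩))

theorem mp_mem (T : MaxTheory n) {φ ψ : MIFml n} (h : MIFml.imp φ ψ ∈ T.carrier)
    (hφ : φ ∈ T.carrier) : ψ ∈ T.carrier :=
  T.closed _ (.impE (φ := φ.toFml) (.hyp ⟨_, h, rfl⟩) (.hyp ⟨_, hφ, rfl⟩))

theorem and_mem_iff (T : MaxTheory n) {φ ψ : MIFml n} :
    MIFml.and φ ψ ∈ T.carrier ↔ φ ∈ T.carrier ∧ ψ ∈ T.carrier :=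
  ⟨fun h => ⟨T.mem_of_derives h (.andE₁ (.hyp rfl)), T.mem_of_derives h (.andE₂ (.hyp rfl))⟩,
    fun h => T.closed _ (.andI (.hyp ⟨_, h.1, rfl⟩) (.hyp ⟨_, h.2, rfl⟩))⟩

end MaxTheory

/-- Zorn's lemma applies directly only when a variable is omitted. Induction on the formula reduces
to that case: omit a conjunct, or add the antecedent and omit the consequent. -/
theorem exists_maxTheory {φ : MIFml n} {Γ : Set (MIFml n)}
    (h : ¬ Derives (MIFml.toFml '' Γ) φ.toFml) :
    ∃ T : MaxTheory n, Γ ⊆ T.carrier ∧ φ ∉ T.carrier := by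
  induction φ generalizing Γ with
  | var q =>
    obtain ⟨Δ, hΓ, hq, hmax⟩ := exists_maximal_not_derives MIFml.toFml h
    have hmax' : ∀ φ ∉ Δ, Derives (MIFml.toFml '' Δ) (.imp φ.toFml (MIFml.var q).toFml) := fun φ hφ =>
      .impI (by simpa only [Set.image_insert_eq] using hmax φ hφ)
    have closed : ∀ φ, Derives (MIFml.toFml '' Δ) φ.toFml → φ ∈ Δ := fun φ hφ => by
      by_contra hn
      exact hq (.impE (hmax' φ hn) hφ)
    have hqΔ : MIFml.var q ∉ Δ := fun hm => hq (.hyp ⟨_, hm, rfl⟩)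
    exact ⟨⟨Δ, closed, q, hqΔ, fun φ hφ => closed _ (hmax' φ hφ)⟩, hΓ, hqΔ⟩
  | top => exact (h .topI).elim
  | and φ ψ ih₁ ih₂ =>
    by_cases hφ : Derives (MIFml.toFml '' Γ) φ.toFml
    · obtain ⟨T, hT, hn⟩ := ih₂ fun hψ => h (.andI hφ hψ)
      exact ⟨T, hT, fun hm => hn (T.and_mem_iff.1 hm).2⟩
    · obtain ⟨T, hT, hn⟩ := ih₁ hφ
      exact ⟨T, hT, fun hm => hn (T.and_mem_iff.1 hm).1⟩
  | imp φ ψ _ ih =>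
    obtain ⟨T, hT, hn⟩ := ih (Γ := insert φ Γ) fun hd =>
      h (.impI (by simpa only [Set.image_insert_eq] using hd))
    exact ⟨T, (Set.subset_insert _ _).trans hT,
      fun hm => hn (T.mp_mem hm (hT (Set.mem_insert _ _)))⟩

namespace MaxTheory

/-- The truth lemma for the model of maximal theories. -/
theorem force_iff {φ : MIFml n} {T : MaxTheory n} :
    Force (colour n) φ.toFml T ↔ φ ∈ T.carrier := by
  induction φ generalizing T with
  | var i => exact Iff.rfl
  | top => exact ⟨fun _ => T.closed _ .topI, fun _ => trivial⟩
  | and φ ψ ih₁ ih₂ =>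
    simp only [MIFml.toFml, Force, ih₁, ih₂, and_mem_iff]
  | imp φ ψ ih₁ ih₂ =>
    simp only [MIFml.toFml, Force, ih₁, ih₂]
    refine ⟨fun h => ?_, fun h S hS hφ => S.mp_mem (hS h) hφ⟩
    by_contra hn
    obtain ⟨S, hS, hψ⟩ := exists_maxTheory (Γ := insert φ T.carrier) (φ := ψ) fun hd =>
      hn (T.closed _ (.impI (by simpa only [Set.image_insert_eq] using hd)))
    exact hψ (h S (fun _ hx => hS (Set.mem_insert_of_mem _ hx)) (hS (Set.mem_insert _ _)))

/-- A proper extension of T contains some `φ ∉ T` together with `φ → q ∈ T`, hence `q`. -/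
theorem exists_isBorder (T : MaxTheory n) : ∃ q, IsBorder (colour n) q T := by
  obtain ⟨q, hq, hmax⟩ := T.maximal
  refine ⟨q, hq, fun S hS => ?_⟩
  obtain ⟨φ, hφS, hφT⟩ := Set.not_subset.1 hS.not_ge
  exact S.mp_mem (hS.le (hmax φ hφT)) hφS

theorem colour_strictMono : StrictMono (colour n) := fun S T h => by
  refine ((colour n).monotone h.le).lt_of_not_ge fun hle => ?_
  obtain ⟨q, hq, hq'⟩ := S.exists_isBorder
  exact hq (hle q (hq' T h))

/-- Downward induction on the colour: a theory is determined by its colour and its set of proper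
successors, and these have strictly larger colours. -/
instance : Finite (MaxTheory n) := by
  have key : ∀ C : Fin n → Prop, {T | colour n T = C}.Finite := by
    intro C
    induction C using WellFoundedGT.induction with
    | ind C ih =>
      have hS : {T | C < colour n T}.Finite :=
        ((Set.toFinite {D | C < D}).biUnion fun D hD => ih D hD).subset fun T hT =>
          Set.mem_biUnion (x := colour n T) hT rfl
      refine Set.Finite.of_finite_image (f := Set.Ioi) (hS.powerset.subset ?_) ?_
      · rintro _ ⟨T, rfl, rfl⟩ S hS
        exact colour_strictMono hS
      · intro S hS T hT h
        refine MaxTheory.ext (Set.ext fun φ => ?_)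
        rw [← force_iff, ← force_iff]
        exact force_iff_of_Ioi_eq (hS.trans hT.symm) h _
  exact Set.finite_univ_iff.1 ((Set.finite_iUnion key).subset fun T _ =>
    Set.mem_iUnion.2 ⟨colour n T, rfl⟩)

end MaxTheory

/-- Diego's theorem. -/
instance : Finite (FreeMI n) := by
  -- A class is determined by the maximal theories containing it, of which there are finitely many.
  refine Finite.of_injective (fun a : FreeMI n => {T : MaxTheory n | a.rep ∈ T.carrier})
    fun a b h => ?_
  have key : ∀ φ ψ : MIFml n, {T : MaxTheory n | φ ∈ T.carrier} ⊆ {T | ψ ∈ T.carrier} →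
      Derives {φ.toFml} ψ.toFml := fun φ ψ h => by
    by_contra hn
    obtain ⟨T, hT, hψ⟩ := exists_maxTheory (Γ := {φ}) (φ := ψ)
      (by simpa only [Set.image_singleton] using hn)
    exact hψ (h (hT rfl))
  exact Quotient.out_equiv_out.1 ⟨key _ _ h.le, key _ _ h.ge⟩

theorem toFml_bigAnd (l : List (MIFml n)) :
    (MIFml.bigAnd l).toFml = Fml.bigAnd (l.map MIFml.toFml) := by
  induction l with
  | nil => rfl
  | cons φ l ih => exact congrArg (Fml.and φ.toFml) ih

theorem force_toFml_bigAnd {X : Type*} [PartialOrder X] {c : X →o (Fin n → Prop)}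
    {l : List (MIFml n)} {x : X} :
    Force c (MIFml.bigAnd l).toFml x ↔ ∀ φ ∈ l, Force c φ.toFml x := by
  rw [toFml_bigAnd, force_bigAnd, List.forall_mem_map]

namespace Universal

/-- The meet-implication theory of a point of `universalMI n`. -/
def miTheory (v : Universal n) (hv : v ∈ universalMI n) : MaxTheory n where
  carrier := {φ | Force (uColour n) φ.toFml v}
  closed _ h := h.force v (by rintro _ ⟨γ, hγ, rfl⟩; exact hγ)
  maximal := by
    obtain ⟨q, hq, hq'⟩ := mem_universalMI_iff.1 hv v le_rfl
    refine ⟨q, hq, fun φ hφ u hu hφu => hq' u (hu.lt_of_ne ?_)⟩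
    rintro rfl
    exact hφ hφu

/-- The counterpart of `exists_theoryAt_eq` without disjunction: the omitted variable `q` replaces
`⋁ m`. A point whose theory properly extends T forces some `ψ ∉ T` and also `ψ → q`, hence `q`. -/
theorem exists_miTheory_eq {v : Universal n} {T : MaxTheory n}
    (hT : ∀ φ : MIFml n, Force (uColour n) φ.toFml v → φ ∈ T.carrier) :
    ∃ u, v ≤ u ∧ T.carrier = {φ | Force (uColour n) φ.toFml u} := by
  by_contra! hne
  obtain ⟨q, hq, hmax⟩ := T.maximal
  obtain ⟨l, hl, hl'⟩ := exists_list_of_finite v.finite_Ici (fun φ : MIFml n => φ ∈ T.carrier)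
    fun φ u => ¬ Force (uColour n) φ.toFml u
  have himp : MIFml.imp (MIFml.bigAnd l) (.var q) ∈ T.carrier := by
    refine hT _ fun u hu hφ => ?_
    rw [force_toFml_bigAnd] at hφ
    have hsub : T.carrier ⊆ {φ | Force (uColour n) φ.toFml u} := fun φ hφT => by
      by_contra hn
      obtain ⟨ψ, hψ, hψ'⟩ := hl' u hu ⟨φ, hφT, hn⟩
      exact hψ' (hφ ψ hψ)
    obtain ⟨ψ, hψ, hψT⟩ := Set.not_subset.1 fun h => hne u hu (hsub.antisymm h)
    exact hsub (hmax ψ hψT) u le_rfl hψ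
  exact hq (T.mp_mem himp (MaxTheory.force_iff.1 (force_toFml_bigAnd.2 fun φ hφ =>
    MaxTheory.force_iff.2 (hl φ hφ))))

/-- Having the same meet-implication theory is a bisimulation, so that theory fixes the truth of all
formulas, including those with ∨ and ⊥. -/
theorem force_miTheory_iff {v : Universal n} (hv : v ∈ universalMI n) {φ : Fml n} :
    Force (MaxTheory.colour n) φ (v.miTheory hv) ↔ Force (uColour n) φ v := by
  refine (force_iff_of_bisim (fun (v : Universal n) (T : MaxTheory n) => v ∈ universalMI n ∧
    T.carrier = {φ | Force (uColour n) φ.toFml v}) ?_ ?_ ?_ φ v _ ⟨hv, rfl⟩).symm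
  · rintro v T ⟨-, hT⟩
    ext i
    exact Set.ext_iff.1 hT (.var i)
  · rintro v T ⟨hv, hT⟩ u hu
    have hu' := isUpperSet_universalMI hu hv
    refine ⟨u.miTheory hu', ?_, hu', rfl⟩
    change T.carrier ⊆ _
    rw [hT]
    exact fun φ hφ => Force.mono hu hφ
  · rintro v T ⟨hv, hT⟩ S hS
    obtain ⟨u, hu, h⟩ := exists_miTheory_eq (v := v) (T := S) fun φ hφ => hS (hT ▸ hφ)
    exact ⟨u, hu, isUpperSet_universalMI hu hv, h⟩

/-- The order of `universalMI n` is the inclusion of meet-implication theories. -/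
theorem le_of_force_toFml {u v : Universal n} (hu : u ∈ universalMI n) (hv : v ∈ universalMI n)
    (h : ∀ φ : MIFml n, Force (uColour n) φ.toFml v → Force (uColour n) φ.toFml u) : v ≤ u := by
  intro φ hφ
  rw [← force_iff] at hφ ⊢
  exact (force_miTheory_iff hu).1
    (Force.mono (x := v.miTheory hv) h ((force_miTheory_iff hv).2 hφ))

end Universal

/-- Completeness of the meet-implication fragment with respect to `universalMI n`. -/
theorem derives_toFml_of_forall {φ ψ : MIFml n} (h : ∀ v ∈ universalMI n,
    Force (uColour n) φ.toFml v → Force (uColour n) ψ.toFml v) :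
    Derives {φ.toFml} ψ.toFml := by
  by_contra hn
  obtain ⟨T, hT, hψ⟩ := exists_maxTheory (Γ := {φ}) (φ := ψ)
    (by simpa only [Set.image_singleton] using hn)
  -- Every maximal theory is a border point and `t` preserves border points, so its image lies in
  -- `universalMI n`.
  let t := theoryMap (MaxTheory.colour n) fun T => Set.toFinite (Set.Ici T)
  have hf : ∀ φ, Force (uColour n) φ (t T) ↔ Force (MaxTheory.colour n) φ T := fun φ =>
    Universal.force_iff.trans mem_theoryMap
  have ht : t T ∈ universalMI n := by
    rw [mem_universalMI_iff]
    intro v hv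
    obtain ⟨S, -, rfl⟩ := t.exists_map_eq_of_map_le' hv
    obtain ⟨q, hq⟩ := S.exists_isBorder
    exact ⟨q, hq.map preservesColour_theoryMap⟩
  have := h _ ht ((hf _).2 (MaxTheory.force_iff.2 (hT rfl)))
  exact hψ (MaxTheory.force_iff.1 ((hf _).1 this))

/-! ### Definability in `universalMI n` and the translation `s` -/

theorem derives_mk_rep (φ : MIFml n) :
    Derives {(FreeMI.rep (Quotient.mk (miSetoid n) φ)).toFml} φ.toFml :=
  (Quotient.mk_out (s := miSetoid n) φ).1

theorem derives_rep_mk (φ : MIFml n) :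
    Derives {φ.toFml} (FreeMI.rep (Quotient.mk (miSetoid n) φ)).toFml :=
  (Quotient.mk_out (s := miSetoid n) φ).2

theorem force_of_derives {X : Type*} [PartialOrder X] {c : X →o (Fin n → Prop)} {φ ψ : Fml n}
    (h : Derives {φ} ψ) {x : X} (hx : Force c φ x) : Force c ψ x :=
  h.force x (by rintro _ rfl; exact hx)

/-- Complements of principal down-sets of `universalMI n` are definable. -/
theorem exists_force_iff_not_le {v : Universal n} (hv : v ∈ universalMI n) :
    ∃ χ : MIFml n, ∀ u ∈ universalMI n, Force (uColour n) χ.toFml u ↔ ¬ u ≤ v := by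
  obtain ⟨q, hq, hq'⟩ := mem_universalMI_iff.1 hv v le_rfl
  -- By Diego's theorem a finite list axiomatizes the meet-implication theory of `v`. It holds
  -- exactly above `v` within `universalMI n`, and `q` holds strictly above `v` but not at `v`, so
  -- `⋀ l → q` fails exactly below `v`.
  let l : List (MIFml n) := ((Set.toFinite {a : FreeMI n |
    Force (uColour n) a.rep.toFml v}).toFinset.toList).map FreeMI.rep
  have hl : ∀ u, Force (uColour n) (MIFml.bigAnd l).toFml u ↔
      ∀ φ : MIFml n, Force (uColour n) φ.toFml v → Force (uColour n) φ.toFml u := by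
    intro u
    simp only [force_toFml_bigAnd, l, List.forall_mem_map, Finset.mem_toList,
      Set.Finite.mem_toFinset, Set.mem_ofPred_eq]
    exact ⟨fun h φ hφ => force_of_derives (derives_mk_rep φ)
      (h (Quotient.mk _ φ) (force_of_derives (derives_rep_mk φ) hφ)), fun h a => h a.rep⟩
  refine ⟨.imp (.bigAnd l) (.var q), fun u hu => ⟨fun h huv => ?_, fun h t ht htl => ?_⟩⟩
  · exact hq (h v huv ((hl v).2 fun _ => id))
  · have hvt := Universal.le_of_force_toFml (isUpperSet_universalMI ht hu) hv ((hl t).1 htl)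
    exact hq' t (hvt.lt_of_ne (by rintro rfl; exact h ht))

theorem force_meet {X : Type*} [PartialOrder X] {c : X →o (Fin n → Prop)} {S : Set (FreeMI n)}
    {x : X} : Force c (FreeMI.meet S).toFml x ↔ ∀ a ∈ S, Force c a.rep.toFml x := by
  rw [FreeMI.meet, dif_pos S.toFinite, force_toFml_bigAnd]
  simp

/-- On `universalMI n`, the operation `⊻` is disjunction. -/
theorem force_veebar {φ ψ : MIFml n} {v : Universal n} (hv : v ∈ universalMI n) :
    Force (uColour n) (MIFml.veebar φ ψ).toFml v ↔
      Force (uColour n) φ.toFml v ∨ Force (uColour n) ψ.toFml v := by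
  rw [MIFml.veebar, force_meet]
  constructor
  · intro h
    by_contra! hn
    -- If `v` forces neither formula, no point forcing either lies below `v`; so `χ` is a common
    -- upper bound that fails at `v`.
    obtain ⟨χ, hχ⟩ := exists_force_iff_not_le hv
    have key : ∀ φ : MIFml n, ¬ Force (uColour n) φ.toFml v →
        FreeMI.le (Quotient.mk (miSetoid n) φ) (Quotient.mk (miSetoid n) χ) := fun φ hφ =>
      ((derives_mk_rep φ).cut (derives_toFml_of_forall fun u hu hφu =>
        (hχ u hu).2 fun huv => hφ (hφu.mono huv))).cut (derives_rep_mk χ)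
    exact (hχ v hv).1 (force_of_derives (derives_mk_rep χ) (h _ ⟨key φ hn.1, key ψ hn.2⟩)) le_rfl
  · rintro (h | h) a ⟨h₁, h₂⟩
    · exact force_of_derives h₁ (force_of_derives (derives_rep_mk φ) h)
    · exact force_of_derives h₂ (force_of_derives (derives_rep_mk ψ) h)

/-- On `universalMI n`, the translation `s` preserves truth. -/
theorem force_s {φ : Fml n} {v : Universal n} (hv : v ∈ universalMI n) :
    Force (uColour n) φ.s.toFml v ↔ Force (uColour n) φ v := by
  induction φ generalizing v with
  | var i => exact Iff.rfl
  | bot =>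
    refine ⟨fun h => ?_, False.elim⟩
    -- A separated point falsifies some variable, so `⊥` and the conjunction of all variables agree
    -- here.
    obtain ⟨q, hq, -⟩ := mem_universalMI_iff.1 hv v le_rfl
    exact hq (force_toFml_bigAnd.1 h (.var q) (List.mem_map_of_mem (List.mem_finRange q)))
  | top => exact Iff.rfl
  | and φ ψ ih₁ ih₂ => exact and_congr (ih₁ hv) (ih₂ hv)
  | or φ ψ ih₁ ih₂ => exact (force_veebar hv).trans (or_congr (ih₁ hv) (ih₂ hv))
  | imp φ ψ ih₁ ih₂ =>
    refine forall₂_congr fun u hu => ?_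
    have := isUpperSet_universalMI hu hv
    exact imp_congr (ih₁ this) (ih₂ this)

/-! ### De Jongh formulas -/

theorem Universal.mem_immSucc {w v : Universal n} : v ∈ w.immSucc ↔ w ⋖ v := by
  simp [Universal.immSucc]

theorem Universal.exists_covBy_le {w v : Universal n} (h : w < v) : ∃ w', w ⋖ w' ∧ w' ≤ v := by
  obtain ⟨w', hw', hmin⟩ := (w.finite_Ici.subset
    (show Set.Ioc w v ⊆ _ from fun _ h => h.1.le)).exists_minimal ⟨v, h, le_rfl⟩
  exact ⟨w', ⟨hw'.1, fun u hu hu' => hu'.not_ge (hmin ⟨hu, hu'.le.trans hw'.2⟩ hu'.le)⟩, hw'.2⟩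

theorem force_theta {X : Type*} [PartialOrder X] {c : X →o (Fin n → Prop)} {w : Universal n}
    {x : X} : Force c (theta w) x ↔ ∃ w', w ⋖ w' ∧ Force c (phi w') x := by
  rw [theta, phiTheta, force_bigOr]
  simp [Universal.mem_immSucc, phi]

theorem force_phi {X : Type*} [PartialOrder X] {c : X →o (Fin n → Prop)} {w : Universal n}
    {x : X} : Force c (phi w) x ↔ (∀ p, uColour n w p → c x p) ∧
      (∀ q, IsBorder (uColour n) q w → Force c (.imp (.var q) (theta w)) x) ∧
      ∀ w', w ⋖ w' → Force c (.imp (psi w') (theta w)) x := by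
  rw [phi, theta, phiTheta]
  simp only [Force, force_bigAnd]
  simp [Universal.mem_immSucc, Force, psi, phi, theta]

/-- A point with the colour and the proper successors of `w`, up to points that look like `w`,
is `w`. -/
theorem Universal.eq_of_forall_le {v w : Universal n}
    (hc : ∀ u, v ≤ u → ¬ w < u → uColour n u = uColour n w)
    (hle : ∀ u, v ≤ u → ¬ w < u → ∀ t, w < t → u ≤ t) (hv : ¬ w < v) : v = w := by
  refine Universal.ext_force fun φ => force_iff_of_bisim
    (fun a b => a = b ∨ b = w ∧ v ≤ a ∧ ¬ w < a) ?_ ?_ ?_ φ v w (.inr ⟨rfl, le_rfl, hv⟩)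
  · rintro a b (rfl | ⟨rfl, h, h'⟩)
    exacts [rfl, (hc a h h').symm]
  · rintro a b (rfl | ⟨rfl, h, h'⟩) z hz
    · exact ⟨z, hz, .inl rfl⟩
    · by_cases hbz : b < z
      · exact ⟨z, hbz.le, .inl rfl⟩
      · exact ⟨b, le_rfl, .inr ⟨rfl, h.trans hz, hbz⟩⟩
  · rintro a b (rfl | ⟨rfl, h, h'⟩) z hz
    · exact ⟨z, hz, .inl rfl⟩
    · rcases hz.eq_or_lt with rfl | hz
      · exact ⟨a, le_rfl, .inr ⟨rfl, h, h'⟩⟩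
      · exact ⟨z, hle a h h' z hz, .inl rfl⟩

theorem force_theta_iff_of_force_phi {v w : Universal n}
    (ih : ∀ w', w < w' → ∀ v, Force (uColour n) (phi w') v ↔ w' ≤ v) :
    Force (uColour n) (theta w) v ↔ w < v := by
  rw [force_theta]
  constructor
  · rintro ⟨w', hw', h⟩
    exact hw'.lt.trans_le ((ih w' hw'.lt v).1 h)
  · intro h
    obtain ⟨w', hw', hle⟩ := Universal.exists_covBy_le h
    exact ⟨w', hw', (ih w' hw'.lt v).2 hle⟩

theorem force_psi_iff_of_force_phi {v w : Universal n}
    (ih : ∀ w', w ≤ w' → ∀ v, Force (uColour n) (phi w') v ↔ w' ≤ v) :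
    Force (uColour n) (psi w) v ↔ ¬ v ≤ w := by
  simp only [psi, Force, force_theta_iff_of_force_phi fun w' h => ih w' h.le, ih w le_rfl]
  exact ⟨fun h hvw => (h w hvw le_rfl).false, fun h u hu hwu =>
    hwu.lt_of_ne (by rintro rfl; exact h hu)⟩

/-- The formula `φ_w` defines the up-set generated by `w`. -/
theorem force_phi_iff {v w : Universal n} : Force (uColour n) (phi w) v ↔ w ≤ v := by
  induction hk : (Set.Ici w).ncard using Nat.strong_induction_on generalizing v w with
  | _ k ih =>
    replace ih : ∀ w', w < w' → ∀ v, Force (uColour n) (phi w') v ↔ w' ≤ v := fun w' h v =>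
      ih _ (hk ▸ Set.ncard_lt_ncard (Set.Ici_ssubset_Ici.2 h) w.finite_Ici) rfl
    have hψ : ∀ w', w ⋖ w' → ∀ v, Force (uColour n) (psi w') v ↔ ¬ v ≤ w' := fun w' h v =>
      force_psi_iff_of_force_phi fun t ht => ih t (h.lt.trans_le ht)
    have hθ : ∀ v, Force (uColour n) (theta w) v ↔ w < v := fun v =>
      force_theta_iff_of_force_phi ih
    rw [force_phi]
    simp only [Force, hθ]
    constructor
    · rintro ⟨h₁, h₂, h₃⟩
      by_cases hv : w < v
      · exact hv.le
      -- Where `θ_w` fails, the third conjunct makes each `ψ_{w'}` fail, which puts `u` below every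
      -- immediate successor of `w`.
      have hle : ∀ u, v ≤ u → ¬ w < u → ∀ t, w < t → u ≤ t := fun u hu hn t ht => by
        obtain ⟨w', hw', hw't⟩ := Universal.exists_covBy_le ht
        refine le_trans ?_ hw't
        by_contra hn'
        exact hn (h₃ w' hw' u hu ((hψ w' hw' u).2 hn'))
      refine (Universal.eq_of_forall_le (fun u hu hn => ?_) hle hv).ge
      refine le_antisymm (fun p hp => ?_) fun p hp => (uColour n).monotone hu p (h₁ p hp)
      by_contra hwp
      -- A variable true at `u` and false at `w` holds at all proper successors of `w`, making `w` a
      -- border point; the second conjunct then gives `θ_w` at `u`.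
      refine hn (h₂ p ⟨hwp, fun t ht => ?_⟩ u hu hp)
      exact (uColour n).monotone (hle u hu hn t ht) p hp
    · intro h
      refine ⟨fun p hp => (uColour n).monotone h p hp, fun q hq u hu hqu => ?_,
        fun w' hw' u hu hu' => ?_⟩
      · exact (h.trans hu).lt_of_ne (by rintro rfl; exact hq.1 hqu)
      · refine (h.trans hu).lt_of_ne ?_
        rintro rfl
        exact (hψ w' hw' w).1 hu' hw'.le

/-- The formula `ψ_w` defines the complement of the down-set generated by `w`. -/
theorem force_psi_iff {v w : Universal n} : Force (uColour n) (psi w) v ↔ ¬ v ≤ w :=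
  force_psi_iff_of_force_phi fun _ _ _ => force_phi_iff

theorem force_s_psi_iff {v w : Universal n} (hv : v ∈ universalMI n) :
    Force (uColour n) (psi w).s.toFml v ↔ ¬ v ≤ w :=
  (force_s hv).trans force_psi_iff

/-! ### Heyting algebras -/

theorem Derives.le_eval {B : Type*} [HeytingAlgebra B] {Γ : Set (Fml n)} {φ : Fml n}
    (h : Derives Γ φ) (a : Fin n → B) : ∀ b, (∀ γ ∈ Γ, b ≤ γ.eval a) → b ≤ φ.eval a := by
  induction h with
  | hyp h => exact fun b hb => hb _ h
  | topI => exact fun _ _ => le_top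
  | botE _ ih => exact fun b hb => (ih b hb).trans bot_le
  | andI _ _ ih₁ ih₂ => exact fun b hb => le_inf (ih₁ b hb) (ih₂ b hb)
  | andE₁ _ ih => exact fun b hb => (ih b hb).trans inf_le_left
  | andE₂ _ ih => exact fun b hb => (ih b hb).trans inf_le_right
  | orI₁ _ ih => exact fun b hb => (ih b hb).trans le_sup_left
  | orI₂ _ ih => exact fun b hb => (ih b hb).trans le_sup_right
  | orE _ _ _ ih₁ ih₂ ih₃ =>
    intro b hb
    rw [← inf_eq_left.2 (ih₁ b hb), Fml.eval, inf_sup_left]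
    refine sup_le (ih₂ _ ?_) (ih₃ _ ?_) <;> rw [Set.forall_mem_insert] <;>
      exact ⟨inf_le_right, fun γ hγ => inf_le_left.trans (hb γ hγ)⟩
  | impI _ ih =>
    refine fun b hb => le_himp_iff.2 (ih _ ?_)
    rw [Set.forall_mem_insert]
    exact ⟨inf_le_right, fun γ hγ => inf_le_left.trans (hb γ hγ)⟩
  | impE _ _ ih₁ ih₂ => exact fun b hb => (le_inf (ih₁ b hb) (ih₂ b hb)).trans himp_inf_le

theorem eval_le_of_derives {B : Type*} [HeytingAlgebra B] {φ ψ : Fml n} (h : Derives {φ} ψ)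
    (a : Fin n → B) : φ.eval a ≤ ψ.eval a :=
  h.le_eval a _ (by rintro _ rfl; exact le_rfl)

theorem map_top_of_map_himp {A B : Type*} [HeytingAlgebra A] [HeytingAlgebra B] {g : A → B}
    (himp : ∀ a b, g (a ⇨ b) = g a ⇨ g b) : g ⊤ = ⊤ := by
  rw [← himp_self (a := (⊤ : A)), himp, himp_self]

theorem eval_toFml_comp {A B : Type*} [HeytingAlgebra A] [HeytingAlgebra B] {g : A → B}
    (hinf : ∀ a b, g (a ⊓ b) = g a ⊓ g b) (himp : ∀ a b, g (a ⇨ b) = g a ⇨ g b) (a : Fin n → A)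
    (φ : MIFml n) : φ.toFml.eval (g ∘ a) = g (φ.toFml.eval a) := by
  induction φ with
  | var i => rfl
  | top => exact (map_top_of_map_himp himp).symm
  | and φ ψ ih₁ ih₂ => exact (congrArg₂ (· ⊓ ·) ih₁ ih₂).trans (hinf _ _).symm
  | imp φ ψ ih₁ ih₂ => exact (congrArg₂ (· ⇨ ·) ih₁ ih₂).trans (himp _ _).symm

section UpAlg

variable {F : Type*} [PartialOrder F]

theorem mem_himp_upAlg {U V : UpAlg F} {x : F} : x ∈ OrderDual.ofDual (U ⇨ V) ↔
    ∀ y, x ≤ y → y ∈ OrderDual.ofDual U → y ∈ OrderDual.ofDual V := by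
  constructor
  · intro h y hxy hy
    have hle : (U ⇨ V) ⊓ U ≤ V := himp_inf_le
    exact hle (show y ∈ OrderDual.ofDual ((U ⇨ V) ⊓ U) from
      ⟨(OrderDual.ofDual (U ⇨ V)).upper hxy h, hy⟩)
  · intro h
    have hle : OrderDual.toDual (UpperSet.Ici x) ≤ U ⇨ V := by
      rw [le_himp_iff]
      exact fun y hy => h y hy.1 hy.2
    exact hle (show x ∈ UpperSet.Ici x from le_rfl)

/-- The up-sets of points at which the variables are true. -/
def upValuation (c : F →o (Fin n → Prop)) (i : Fin n) : UpAlg F :=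
  OrderDual.toDual ⟨{x | c x i}, fun _ _ h hx => c.monotone h i hx⟩

theorem mem_eval_upValuation {c : F →o (Fin n → Prop)} {φ : MIFml n} {x : F} :
    x ∈ OrderDual.ofDual (φ.toFml.eval (upValuation c)) ↔ Force c φ.toFml x := by
  induction φ generalizing x with
  | var i => exact Iff.rfl
  | top => exact ⟨fun _ => trivial, fun _ => Set.mem_univ x⟩
  | and φ ψ ih₁ ih₂ => exact and_congr ih₁ ih₂
  | imp φ ψ ih₁ ih₂ =>
    exact mem_himp_upAlg.trans (forall₂_congr fun y _ => imp_congr ih₁ ih₂)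

/-- A map out of the algebra of up-sets of a rooted poset that preserves `∧` and `→` is injective
if it does not send the set of all points but the root to `⊤`. -/
theorem injective_of_rooted {B : Type*} [HeytingAlgebra B] {r : F} (hr : ∀ x, r ≤ x)
    {g : UpAlg F → B} (hinf : ∀ a b, g (a ⊓ b) = g a ⊓ g b)
    (himp : ∀ a b, g (a ⇨ b) = g a ⇨ g b) {R : UpAlg F}
    (hR : ∀ x, x ≠ r → x ∈ OrderDual.ofDual R) (hg : g R ≠ ⊤) : Function.Injective g := by
  have hmono : ∀ a b, a ≤ b → g a ≤ g b := fun a b h => by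
    rw [← inf_eq_left.2 h, hinf]
    exact inf_le_right
  have key : ∀ a b, g a = g b → a ≤ b := by
    intro a b hab
    have htop : g (a ⇨ b) = ⊤ := by rw [himp, hab, himp_self]
    by_contra hn
    -- If `a ≰ b`, then `a ⇨ b` misses the root and so lies below R, although its image is `⊤`.
    have hra : r ∉ OrderDual.ofDual (a ⇨ b) := fun h =>
      hn fun x hx => mem_himp_upAlg.1 h x (hr x) hx
    refine hg (top_le_iff.1 (htop ▸ hmono _ _ fun x hx => hR x ?_))
    rintro rfl
    exact hra hx
  exact fun a b h => (key a b h).antisymm (key b a h.symm)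

end UpAlg

/-! ### Subframe formulas -/

namespace IsGenSubmodelIso

variable {F : Type*} [PartialOrder F] {c : F →o (Fin n → Prop)} {f : F ↪o Universal n}

theorem force_iff (hf : IsGenSubmodelIso c f) (φ : Fml n) (x : F) :
    Force (uColour n) φ (f x) ↔ Force c φ x := by
  refine force_map_iff f.monotone hf.colour (fun x y h => ?_) φ x
  obtain ⟨z, rfl⟩ := hf.upper h ⟨x, rfl⟩
  exact ⟨z, f.le_iff_le.1 h, rfl⟩

end IsGenSubmodelIso

/-- The model given by an enumeration of a finite poset is a generated submodel of
`universalMI n`. -/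
theorem exists_isGenSubmodelIso {F : Type*} [PartialOrder F] [Finite F] (e : Fin n ≃ F) :
    ∃ f : F ↪o Universal n, IsGenSubmodelIso (stdColour e) f := by
  let t := theoryMap (stdColour e) fun x => Set.toFinite (Set.Ici x)
  have hle : ∀ x y, t x ≤ t y ↔ x ≤ y := by
    refine fun x y => ⟨fun h => ?_, fun h => t.monotone' h⟩
    by_contra hn
    obtain ⟨j, rfl⟩ := e.surjective y
    -- The variable `p_j` is true at `x` because `x ≰ x_j`, but false at `x_j`.
    exact (show ¬ ¬ e j ≤ e j from not_not.2 le_rfl) (h (a := .var j) hn)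
  refine ⟨OrderEmbedding.ofMapLEIff t hle, fun _ => rfl, ?_, ?_⟩
  · rintro _ v hv ⟨x, rfl⟩
    obtain ⟨y, -, rfl⟩ := t.exists_map_eq_of_map_le' hv
    exact ⟨y, rfl⟩
  · rintro _ ⟨x, rfl⟩
    refine mem_universalMI_iff.2 fun v hv => ?_
    obtain ⟨y, -, rfl⟩ := t.exists_map_eq_of_map_le' hv
    obtain ⟨j, rfl⟩ := e.surjective y
    have hj : IsBorder (stdColour e) j (e j) := ⟨not_not.2 le_rfl, fun z hz => hz.not_ge⟩
    exact ⟨j, hj.map preservesColour_theoryMap⟩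

theorem refutes_subframeFormula_of_miEmbeds {F : Type*} [PartialOrder F]
    {c : F →o (Fin n → Prop)} {f : F ↪o Universal n} (hf : IsGenSubmodelIso c f) {r : F} {B : Type*}
    [HeytingAlgebra B] (h : MIEmbeds (UpAlg F) B) :
    Refutes B (subframeFormula f r).toFml := by
  obtain ⟨g, hg, hinf, himp⟩ := h
  refine ⟨g ∘ upValuation c, fun htop => ?_⟩
  rw [eval_toFml_comp hinf himp, ← map_top_of_map_himp himp] at htop
  have hr : r ∈ OrderDual.ofDual ((subframeFormula f r).toFml.eval (upValuation c)) := by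
    rw [hg htop]
    exact Set.mem_univ r
  rw [mem_eval_upValuation, ← hf.force_iff] at hr
  exact (force_s_psi_iff (hf.subset ⟨r, rfl⟩)).1 hr le_rfl

section Subframe

variable {F : Type*} [PartialOrder F] [Finite F] {c : F →o (Fin n → Prop)}
  {f : F ↪o Universal n}

/-- The meet-implication formula defining the points of `universalMI n` that are not below any
point `f x` with `x ∉ U`. -/
noncomputable def upSetFormula (f : F ↪o Universal n) (U : UpAlg F) : MIFml n :=
  MIFml.bigAnd ((Set.toFinite {x | x ∉ OrderDual.ofDual U}).toFinset.toList.map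
    fun x => (psi (f x)).s)

theorem force_upSetFormula {U : UpAlg F} {v : Universal n}
    (hv : v ∈ universalMI n) : Force (uColour n) (upSetFormula f U).toFml v ↔
      ∀ x, x ∉ OrderDual.ofDual U → ¬ v ≤ f x := by
  simp [upSetFormula, force_toFml_bigAnd, force_s_psi_iff hv]

/-- Completeness turns equivalence on `universalMI n` into provable equivalence, hence into an
identity in every Heyting algebra. -/
theorem eval_eq_of_forall {B : Type*} [HeytingAlgebra B] {φ ψ : MIFml n} (a : Fin n → B)
    (h : ∀ v ∈ universalMI n,
      (Force (uColour n) φ.toFml v ↔ Force (uColour n) ψ.toFml v)) :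
    φ.toFml.eval a = ψ.toFml.eval a :=
  (eval_le_of_derives (derives_toFml_of_forall fun v hv => (h v hv).1) a).antisymm
    (eval_le_of_derives (derives_toFml_of_forall fun v hv => (h v hv).2) a)

theorem miEmbeds_of_refutes_subframeFormula (hf : IsGenSubmodelIso c f) {r : F}
    (hr : ∀ x, r ≤ x) {B : Type*} [HeytingAlgebra B]
    (h : Refutes B (subframeFormula f r).toFml) : MIEmbeds (UpAlg F) B := by
  obtain ⟨a, ha⟩ := h
  let g : UpAlg F → B := fun U => (upSetFormula f U).toFml.eval a
  have hinf : ∀ U V, g (U ⊓ V) = g U ⊓ g V := fun U V =>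
    eval_eq_of_forall (ψ := .and (upSetFormula f U) (upSetFormula f V)) a fun v hv => by
      simp only [MIFml.toFml, Force, force_upSetFormula hv]
      rw [← forall_and]
      refine forall_congr' fun x => ?_
      rw [show x ∈ OrderDual.ofDual (U ⊓ V) ↔ x ∈ OrderDual.ofDual U ∧ x ∈ OrderDual.ofDual V
        from Iff.rfl]
      tauto
  have himp : ∀ U V, g (U ⇨ V) = g U ⇨ g V := fun U V =>
    eval_eq_of_forall (ψ := .imp (upSetFormula f U) (upSetFormula f V)) a fun v hv => by
      rw [force_upSetFormula hv]
      constructor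
      · intro h u hu hU
        have hu' := isUpperSet_universalMI hu hv
        rw [force_upSetFormula hu'] at hU ⊢
        intro x hxV hux
        refine h x (fun hx => ?_) (hu.trans hux)
        -- Since `u` lies below `f x` and satisfies the formula of U, `x` must belong to U; were it
        -- in `U ⇨ V`, it would lie in V.
        exact hxV (mem_himp_upAlg.1 hx x le_rfl (by_contra fun hxU => hU x hxU hux))
      · intro h x hx hvx
        rw [mem_himp_upAlg] at hx
        push Not at hx
        obtain ⟨y, hxy, hyU, hyV⟩ := hx
        have hvy : v ≤ f y := hvx.trans (f.monotone hxy)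
        have hy := hf.subset ⟨y, rfl⟩
        -- The point `f y` with `y ∈ U`, `y ∉ V` refutes the implication: `f` reflects the order, so
        -- `f y` is below no `f z` with `z ∉ U`.
        refine (force_upSetFormula hy).1 (h (f y) hvy ((force_upSetFormula hy).2 ?_)) y hyV
          le_rfl
        exact fun z hz hyz =>
          hz ((OrderDual.ofDual U).upper (f.le_iff_le.1 hyz) hyU)
  -- The largest proper up-set omits only `r`, so its formula reduces to `s(ψ_{f r})`.
  let R : UpAlg F := OrderDual.toDual ⟨{x | x ≠ r}, fun x y hxy hx hy =>
    hx ((hy ▸ hxy).antisymm (hr x))⟩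
  refine ⟨g, injective_of_rooted hr hinf himp (R := R) (fun _ => id) ?_, hinf, himp⟩
  have hR : g R = (subframeFormula f r).toFml.eval a := eval_eq_of_forall a fun v hv => by
    rw [force_upSetFormula hv, subframeFormula, force_s_psi_iff hv]
    exact ⟨fun h => h r (not_not.2 rfl), fun h x hx => not_not.1 hx ▸ h⟩
  rwa [hR]

end Subframe

end IPC

theorem mainTheorem8 {F : Type*} [PartialOrder F] [Finite F] (r : F) (hr : ∀ x : F, r ≤ x) :
    (∀ (n : ℕ) (e : Fin n ≃ F), ∃ f : F ↪o IPC.Universal n,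
      IPC.IsGenSubmodelIso (IPC.stdColour e) f) ∧
    ∀ (n : ℕ) (c : F →o (Fin n → Prop)) (f : F ↪o IPC.Universal n), IPC.IsGenSubmodelIso c f →
      ∀ (B : Type*) [HeytingAlgebra B],
        IPC.Refutes B (IPC.subframeFormula f r).toFml ↔ IPC.MIEmbeds (IPC.UpAlg F) B :=
  ⟨fun _ e => IPC.exists_isGenSubmodelIso e, fun _ _ _ hf _ _ =>
    ⟨IPC.miEmbeds_of_refutes_subframeFormula hf hr,
      IPC.refutes_subframeFormula_of_miEmbeds hf⟩⟩
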